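/- Let $k$ be a field and let $\mathcal C$ be a skeletally small, Hom-finite, Krull–Schmidt, triangulated $k$-category with suspension $\Sigma$ and with Serre duality, i.e. with an autoequivalence $\nu$ of $\mathcal C$ and $k$-linear isomorphisms $\operatorname{Hom}_{\mathcal C}(X,Y)\simeq \operatorname{Hom}_k(\operatorname{Hom}_{\mathcal C}(Y,\nu X),k)$, natural in $X$ and $Y$. Let $T$ be a rigid object of $\mathcal C$, i.e. $\operatorname{Hom}_{\mathcal C}(T,\Sigma T)=0$. Let $\mathcal X_T$ be the class of objects $X$ with $\operatorname{Hom}_{\mathcal C}(T,X)=0$, and let $Q\colon\mathcal C\to\mathcal C/\mathcal X_T$ be the quotient of $\mathcal C$ by the ideal of morphisms factoring through an object of $\mathcal X_T$. Let $\mathcal R$ be the class of regular morphisms (those that are both monomorphisms and epimorphisms) of $\mathcal C/\mathcal X_T$, and let $L_{\mathcal R}\colon\mathcal C/\mathcal X_T\to(\mathcal C/\mathcal X_T)_{\mathcal R}$ be the Gabriel–Zisman localisation at $\mathcal R$. Write $\operatorname{mod}\operatorname{End}_{\mathcal C}(T)^{op}$ for the category of finitely generated left modules over $\operatorname{End}_{\mathcal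 C}(T)^{op}$. The functor $H=\operatorname{Hom}_{\mathcal C}(T,-)\colon\mathcal C\to\operatorname{mod}\operatorname{End}_{\mathcal C}(T)^{op}$ factors uniquely as $H=H'L_{\mathcal R}Q$ for a functor $H'\colon(\mathcal C/\mathcal X_T)_{\mathcal R}\to\operatorname{mod}\operatorname{End}_{\mathcal C}(T)^{op}$. Then $(\mathcal C/\mathcal X_T)_{\mathcal R}$ has an additive structure on its Hom-sets for which $L_{\mathcal R}$ is an additive functor. For any such structure, regard $\operatorname{Hom}_{(\mathcal C/\mathcal X_T)_{\mathcal R}}(T,-)$ as a functor to $\operatorname{End}_{\mathcal C}(T)^{op}$-modules through the ring homomorphism $\operatorname{End}_{\mathcal C}(T)\to\operatorname{End}_{(\mathcal C/\mathcal X_T)_{\mathcal R}}(T)$ induced by $L_{\mathcal R}Q$. Then $H'$ is naturally isomorphic to $\operatorname{Hom}_{(\mathcal C/\mathcal X_T)_{\mathcal R}}(T,-)$, and the latter gives an equivalence between $(\mathcal C/\mathcal X_T)_{\mathcal R}$ and $\operatorname{mod}\operatorname{End}_{\mathcal C}(T)^{op}$. Hence $H'$ is an equivalence of categories. -/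

import Mathlib

open CategoryTheory CategoryTheory.Limits

universe w v u

namespace RigidLocalisation

noncomputable section

section Assumptions

/-- Every object is a finite direct sum of objects with local endomorphism rings. -/
def IsKrullSchmidt (C : Type u) [Category.{v} C] [Preadditive C] [HasFiniteBiproducts C] : Prop :=
  ∀ X : C, ∃ (n : ℕ) (Y : Fin n → C),
    (∀ i, IsLocalRing (End (Y i))) ∧ Nonempty (X ≅ ⨁ Y)

/-- There are an autoequivalence `ν` of `C` and `k`-linear isomorphisms
`Hom(X, Y) ≃ Hom_k(Hom(Y, ν X), k)`, natural in `X` and `Y`. -/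
def HasSerreDuality (k : Type w) [Field k] (C : Type u) [Category.{v} C] [Preadditive C]
    [Linear k C] : Prop :=
  ∃ (ν : C ≌ C) (φ : ∀ X Y : C, (X ⟶ Y) ≃ₗ[k] Module.Dual k (Y ⟶ ν.functor.obj X)),
    ∀ ⦃X' X Y Y' : C⦄ (a : X' ⟶ X) (f : X ⟶ Y) (b : Y ⟶ Y') (g : Y' ⟶ ν.functor.obj X'),
      φ X' Y' (a ≫ f ≫ b) g = φ X Y f (b ≫ g ≫ ν.functor.map a)

/-- `T` is rigid: `Ext¹(T, T) = Hom(T, Σ T) = 0`. -/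
def IsRigid {C : Type u} [Category.{v} C] [Preadditive C] [HasShift C ℤ] (T : C) : Prop :=
  ∀ f : T ⟶ T⟦(1 : ℤ)⟧, f = 0

end Assumptions

section FactorCategory

variable {C : Type u} [Category.{v} C] [Preadditive C]

/-- The class `𝒳_T` of the objects `X` with `Hom(T, X) = 0`. -/
def perp (T : C) : ObjectProperty C := fun X => ∀ f : T ⟶ X, f = 0

/-- Two parallel morphisms are identified if their difference factors through an object
of `𝒳_T`. -/
def factorRel (T : C) : HomRel C := fun X Y f g =>
  ∃ (U : C) (a : X ⟶ U) (b : U ⟶ Y), perp T U ∧ f - g = a ≫ b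

lemma factorRel_add [HasBinaryBiproducts C] (T : C) ⦃X Y : C⦄ (f₁ f₂ g₁ g₂ : X ⟶ Y)
    (h : factorRel T f₁ f₂) (h' : factorRel T g₁ g₂) :
    factorRel T (f₁ + g₁) (f₂ + g₂) := by
  obtain ⟨U, a, b, hU, e⟩ := h
  obtain ⟨U', a', b', hU', e'⟩ := h'
  refine ⟨U ⊞ U', biprod.lift a a', biprod.desc b b', fun f => ?_, ?_⟩
  · apply biprod.hom_ext
    · simpa using hU (f ≫ biprod.fst)
    · simpa using hU' (f ≫ biprod.snd)
  · rw [biprod.lift_desc, ← e, ← e']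
    abel

variable [HasZeroObject C] [HasBinaryBiproducts C]

open scoped ZeroObject in
instance (T : C) : Congruence (factorRel T) where
  comp_left f g g' := by
    rintro ⟨U, a, b, hU, e⟩
    exact ⟨U, f ≫ a, b, hU, by rw [← Preadditive.comp_sub, e, Category.assoc]⟩
  comp_right g h := by
    obtain ⟨U, a, b, hU, e⟩ := h
    exact ⟨U, a, b ≫ g, hU, by rw [← Preadditive.sub_comp, e, Category.assoc]⟩
  equivalence :=
    { refl := fun f => ⟨0, 0, 0, fun _ => (isZero_zero C).eq_of_tgt _ _, by simp⟩
      symm := by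
        rintro f g ⟨U, a, b, hU, e⟩
        exact ⟨U, a, -b, hU, by rw [Preadditive.comp_neg, ← e, neg_sub]⟩
      trans := by
        intro f g h hfg hgh
        obtain ⟨U, a, b, hU, e⟩ := factorRel_add T _ _ _ _ hfg hgh
        exact ⟨U, a, b, hU, by rw [← e]; abel⟩ }

/-- The factor category `C/𝒳_T`. -/
abbrev FactorCategory (T : C) : Type u := CategoryTheory.Quotient (factorRel T)

/-- The additive structure of `C/𝒳_T`, induced by the one of `C`. -/
instance (T : C) : Preadditive (FactorCategory T) :=
  CategoryTheory.Quotient.preadditive (factorRel T) (factorRel_add T)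

/-- The quotient functor `C ⥤ C/𝒳_T`. -/
abbrev quotientFunctor (T : C) : C ⥤ FactorCategory T := CategoryTheory.Quotient.functor (factorRel T)

/-- The regular morphisms of `C/𝒳_T`: those that are both monomorphisms and epimorphisms. -/
def regular (T : C) : MorphismProperty (FactorCategory T) :=
  MorphismProperty.monomorphisms _ ⊓ MorphismProperty.epimorphisms _

/-- The Gabriel-Zisman localisation `(C/𝒳_T)_ℛ` at the class of regular morphisms. -/
abbrev Localisation (T : C) : Type u := (regular T).Localization

/-- The localisation functor `C/𝒳_T ⥤ (C/𝒳_T)_ℛ`. -/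
abbrev localisationFunctor (T : C) : FactorCategory T ⥤ Localisation T := (regular T).Q

/-- The object `X` of `C`, regarded as an object of `(C/𝒳_T)_ℛ`. -/
abbrev toLocalisation (T X : C) : Localisation T :=
  (localisationFunctor T).obj ((quotientFunctor T).obj X)

/-- The ring homomorphism `End_C(T) → End(T)` into the endomorphism ring of `T` in `(C/𝒳_T)_ℛ`,
for an additive structure on `(C/𝒳_T)_ℛ` that makes the localisation functor additive. -/
def endHom (T : C) [Preadditive (Localisation T)] [(localisationFunctor T).Additive] :
    End T →+* End (toLocalisation T T) where
  toFun f := (localisationFunctor T).map ((quotientFunctor T).map f)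
  map_one' := (quotientFunctor T ⋙ localisationFunctor T).map_id T
  map_mul' f g := (quotientFunctor T ⋙ localisationFunctor T).map_comp g f
  map_zero' := (localisationFunctor T).map_zero _ _
  map_add' f g := (localisationFunctor T).map_add
    (f := (quotientFunctor T).map f) (g := (quotientFunctor T).map g)

/-- The functor `Hom(T, -)` from `(C/𝒳_T)_ℛ` to the modules over `End_C(T)ᵒᵖ`. -/
def homLocalisation (T : C) [Preadditive (Localisation T)] [(localisationFunctor T).Additive] :
    Localisation T ⥤ ModuleCat.{max u v} (End T)ᵐᵒᵖ :=
  preadditiveCoyonedaObj (toLocalisation T T) ⋙ ModuleCat.restrictScalars (endHom T).op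

end FactorCategory

section InducedFunctor

lemma isFG_hom (k : Type w) [Field k] {C : Type u} [Category.{v} C] [Preadditive C] [Linear k C]
    [∀ X Y : C, Module.Finite k (X ⟶ Y)] (T X : C) : ModuleCat.isFG _ ((preadditiveCoyonedaObj T).obj X) := by
  have : Module.Finite k (T ⟶ X) := inferInstance
  obtain ⟨s, hs⟩ := this.fg_top
  refine ⟨⟨s, ?_⟩⟩
  let N : Submodule (End T)ᵐᵒᵖ (T ⟶ X) := Submodule.span (End T)ᵐᵒᵖ (s : Set (T ⟶ X))
  let N' : Submodule k (T ⟶ X) :=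
    { carrier := N
      add_mem' := N.add_mem
      zero_mem' := N.zero_mem
      smul_mem' := fun c x hx => by
        have h := N.smul_mem (MulOpposite.op (show End T from c • 𝟙 T)) hx
        have e : MulOpposite.op (show End T from c • 𝟙 T) • x = c • x := by
          change (c • 𝟙 T) ≫ x = c • x
          rw [Linear.smul_comp, Category.id_comp]
        rwa [e] at h }
  have hN' : N' = ⊤ := by
    rw [eq_top_iff, ← hs, Submodule.span_le]
    exact Submodule.subset_span
  change N = ⊤
  rw [eq_top_iff]
  intro x _
  have : x ∈ N' := by rw [hN']; trivial
  exact this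

variable (k : Type w) [Field k] {C : Type u} [Category.{v} C] [Preadditive C] [Linear k C]
  [∀ X Y : C, Module.Finite k (X ⟶ Y)]

/-- The functor `H = Hom_C(T, -) : C ⥤ mod End_C(T)ᵒᵖ`. The composite of two elements of
`End T` is taken in the order of functions, so that `(End T)ᵐᵒᵖ` acts from the left on
`Hom_C(T, X)` by precomposition. -/
def homFunctor (T : C) : C ⥤ FGModuleCat.{v} (End T)ᵐᵒᵖ :=
  (ModuleCat.isFG _).lift (preadditiveCoyonedaObj T) (isFG_hom k T)

lemma homFunctor_eq_of_factorRel (T : C) (X Y : C) (f g : X ⟶ Y) (h : factorRel T f g) :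
    (homFunctor k T).map f = (homFunctor k T).map g := by
  obtain ⟨U, a, b, hU, e⟩ := h
  apply ObjectProperty.hom_ext
  apply ModuleCat.hom_ext
  apply LinearMap.ext
  intro (x : T ⟶ X)
  change x ≫ f = x ≫ g
  rw [← sub_eq_zero, ← Preadditive.comp_sub, e, ← Category.assoc, hU (x ≫ a), zero_comp]

variable [HasZeroObject C] [HasBinaryBiproducts C]

/-- The functor `C/𝒳_T ⥤ mod End_C(T)ᵒᵖ` induced by `H`. -/
def homFactor (T : C) : FactorCategory T ⥤ FGModuleCat.{v} (End T)ᵐᵒᵖ :=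
  CategoryTheory.Quotient.lift (factorRel T) (homFunctor k T) (homFunctor_eq_of_factorRel k T)

end InducedFunctor

section InducedOnLocalisation

variable (k : Type w) [Field k] {C : Type u} [Category.{v} C] [Preadditive C] [Linear k C]
  [∀ X Y : C, Module.Finite k (X ⟶ Y)]
  [HasZeroObject C] [HasShift C ℤ] [∀ n : ℤ, (shiftFunctor C n).Additive]
  [Pretriangulated C]

lemma homFactor_inverts (T : C) : (regular T).IsInvertedBy (homFactor k T) := by
  intro X Y f hf
  obtain ⟨X⟩ := X
  obtain ⟨Y⟩ := Y
  obtain ⟨f, rfl⟩ := (quotientFunctor T).map_surjective (X := X) (Y := Y) f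
  obtain ⟨hm, he⟩ := hf
  rw [MorphismProperty.monomorphisms.iff] at hm
  rw [MorphismProperty.epimorphisms.iff] at he
  change IsIso ((homFunctor k T).map f)
  have key : IsIso ((preadditiveCoyonedaObj T).map f) := by
    rw [ConcreteCategory.isIso_iff_bijective]
    constructor
    · change Function.Injective (fun x : T ⟶ X => x ≫ f)
      obtain ⟨Z, h, g', hT⟩ := Pretriangulated.distinguished_cocone_triangle₁ f
      have h0 : (quotientFunctor T).map h = (quotientFunctor T).map 0 := by
        rw [← cancel_mono ((quotientFunctor T).map f), ← Functor.map_comp, ← Functor.map_comp]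
        have : h ≫ f = 0 := Pretriangulated.comp_distTriang_mor_zero₁₂ _ hT
        rw [this, zero_comp]
      rw [CategoryTheory.Quotient.functor_map_eq_iff] at h0
      obtain ⟨U, a, b, hU, e⟩ := h0
      intro x y hxy
      dsimp at hxy
      rw [← sub_eq_zero, ← Preadditive.sub_comp] at hxy
      obtain ⟨z, hz⟩ : ∃ z : T ⟶ Z, x - y = z ≫ h :=
        Pretriangulated.Triangle.coyoneda_exact₂ _ hT (x - y) hxy
      rw [sub_zero] at e
      rw [← sub_eq_zero, hz, e, ← Category.assoc, hU (z ≫ a), zero_comp]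
    · change Function.Surjective (fun x : T ⟶ X => x ≫ f)
      obtain ⟨Z, g, h', hT⟩ := Pretriangulated.distinguished_cocone_triangle f
      have h0 : (quotientFunctor T).map g = (quotientFunctor T).map 0 := by
        rw [← cancel_epi ((quotientFunctor T).map f), ← Functor.map_comp, ← Functor.map_comp]
        have : f ≫ g = 0 := Pretriangulated.comp_distTriang_mor_zero₁₂ _ hT
        rw [this, comp_zero]
      rw [CategoryTheory.Quotient.functor_map_eq_iff] at h0
      obtain ⟨U, a, b, hU, e⟩ := h0
      rw [sub_zero] at e
      intro y
      have hy : y ≫ g = 0 := by rw [e, ← Category.assoc, hU (y ≫ a), zero_comp]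
      obtain ⟨z, hz⟩ := Pretriangulated.Triangle.coyoneda_exact₂ _ hT y hy
      exact ⟨z, hz.symm⟩
  have : IsIso ((ModuleCat.isFG _).ι.map ((homFunctor k T).map f)) := key
  exact isIso_of_reflects_iso _ (ModuleCat.isFG (End T)ᵐᵒᵖ).ι

/-- The functor `H' : (C/𝒳_T)_ℛ ⥤ mod End_C(T)ᵒᵖ` induced by `H = Hom_C(T, -)` through the
universal properties of the quotient and of the localisation. -/
def inducedHom (T : C) : Localisation T ⥤ FGModuleCat.{v} (End T)ᵐᵒᵖ :=
  Localization.Construction.lift (homFactor k T) (homFactor_inverts k T)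

theorem inducedHom_fac (T : C) :
    quotientFunctor T ⋙ localisationFunctor T ⋙ inducedHom k T = homFunctor k T := by
  rw [inducedHom, Localization.Construction.fac]
  exact CategoryTheory.Quotient.lift_spec _ _ _

theorem inducedHom_unique (T : C) (F : Localisation T ⥤ FGModuleCat.{v} (End T)ᵐᵒᵖ)
    (hF : quotientFunctor T ⋙ localisationFunctor T ⋙ F = homFunctor k T) :
    F = inducedHom k T := by
  apply Localization.Construction.uniq
  apply CategoryTheory.Quotient.lift_unique'
  exact hF.trans (inducedHom_fac k T).symm

end InducedOnLocalisation

end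

end RigidLocalisation

namespace RigidLocalisation

/-! ### Modules over the endomorphism ring and powers of `T` -/

section Powers

variable {C : Type u} [Category.{v} C] [Preadditive C]

/-! The functor induced by `H` on `C/𝒳_T` is itself a localisation at the regular morphisms, so `H'`
is an equivalence. Three facts give this. It is faithful: a morphism killed by `Hom(T, -)` factors
through the cone of a right approximation by a power of `T`, and rigidity puts that cone in `𝒳_T`
(`factorRel_zero_of_comp_eq_zero`). It has a fully faithful left adjoint: present a module by some
`Tᵐ ⟶ Tⁿ`; by rigidity `H` sends the cone to that module, and linear maps out of it lift to
morphisms (`exists_iso_homFunctor_obj`). So it is a localisation at the morphisms it inverts. Those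
are exactly the regular ones: a faithful functor reflects monomorphisms and epimorphisms, and
`homFactor_inverts` is the converse. Finally `H'(T)` is free on the identity of `T`, so evaluation
there identifies `Hom(T, -)` on the localisation with `H'`. -/

lemma isNoetherianRing_end_op (k : Type w) [Field k] [Linear k C]
    [∀ X Y : C, Module.Finite k (X ⟶ Y)] (T : C) : IsNoetherianRing (End T)ᵐᵒᵖ := by
  have : Module.Finite k (End T) := inferInstanceAs (Module.Finite k (T ⟶ T))
  have : Module.Finite k (End T)ᵐᵒᵖ := Module.Finite.equiv (MulOpposite.opLinearEquiv k)
  exact IsNoetherianRing.of_finite k _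

variable (k : Type w) [Field k] [Linear k C] [∀ X Y : C, Module.Finite k (X ⟶ Y)] (T : C)

lemma homFunctor_map_apply {X Y : C} (f : X ⟶ Y) (x : T ⟶ X) :
    ((homFunctor k T).map f).hom.hom x = x ≫ f := rfl

lemma homFunctor_map_eq_iff {X Y : C} (f g : X ⟶ Y) :
    (homFunctor k T).map f = (homFunctor k T).map g ↔ ∀ x : T ⟶ X, x ≫ f = x ≫ g := by
  constructor
  · intro h x
    rw [← homFunctor_map_apply k, ← homFunctor_map_apply k, h]
  · intro h
    apply FGModuleCat.hom_ext
    exact LinearMap.ext h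

lemma homFunctor_apply_comp {X : C} {M : FGModuleCat.{v} (End T)ᵐᵒᵖ}
    (φ : (homFunctor k T).obj X ⟶ M) (r : T ⟶ T) (x : T ⟶ X) :
    φ.hom.hom (r ≫ x : T ⟶ X) = MulOpposite.op (show End T from r) • φ.hom.hom x :=
  φ.hom.hom.map_smul (MulOpposite.op (show End T from r)) x

variable [HasFiniteBiproducts C]

/-- The finite power `Tⁿ`. -/
noncomputable abbrev power (T : C) (n : ℕ) : C := ⨁ fun _ : Fin n => T

lemma power_hom_ext {T Y : C} {n : ℕ} {f g : power T n ⟶ Y}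
    (h : ∀ x : T ⟶ power T n, x ≫ f = x ≫ g) : f = g :=
  biproduct.hom_ext' _ _ fun _ => h _

/-- Every finitely generated module is a quotient of `Hom(T, Tⁿ)` for some `n`. -/
lemma exists_surjective_from_power (M : FGModuleCat.{v} (End T)ᵐᵒᵖ) :
    ∃ (n : ℕ) (p : (homFunctor k T).obj (power T n) ⟶ M), Function.Surjective p.hom.hom := by
  obtain ⟨n, m, hm⟩ := Module.Finite.exists_fin (R := (End T)ᵐᵒᵖ) (M := M)
  let q : ((homFunctor k T).obj (power T n)) →ₗ[(End T)ᵐᵒᵖ] M :=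
    { toFun := fun x : T ⟶ power T n =>
        ∑ i, MulOpposite.op (show End T from x ≫ biproduct.π _ i) • m i
      map_add' := fun (x y : T ⟶ power T n) => by
        rw [← Finset.sum_add_distrib]
        refine Finset.sum_congr rfl fun i _ => ?_
        rw [← add_smul, ← MulOpposite.op_add]
        congr 2
        exact Preadditive.add_comp _ _ _ _ _ _
      map_smul' := fun r (x : T ⟶ power T n) => by
        rw [RingHom.id_apply, Finset.smul_sum]
        refine Finset.sum_congr rfl fun i _ => ?_
        rw [smul_smul]
        congr 1
        apply MulOpposite.unop_injective
        exact Category.assoc (MulOpposite.unop r : T ⟶ T) x (biproduct.π _ i) }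
  have hq (i : Fin n) : q (biproduct.ι (fun _ : Fin n => T) i) = m i := by
    change ∑ j, MulOpposite.op (show End T from
      biproduct.ι (fun _ : Fin n => T) i ≫ biproduct.π _ j) • m j = _
    rw [Finset.sum_eq_single i]
    · rw [biproduct.ι_π_self]
      exact one_smul (End T)ᵐᵒᵖ _
    · intro j _ hj
      rw [biproduct.ι_π_ne _ hj.symm]
      exact zero_smul (End T)ᵐᵒᵖ _
    · simp
  refine ⟨n, ⟨ModuleCat.ofHom q⟩, ?_⟩
  change Function.Surjective q
  rw [← LinearMap.range_eq_top, eq_top_iff, ← hm, Submodule.span_le]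
  rintro _ ⟨i, rfl⟩
  exact ⟨_, hq i⟩

/-- Every linear map `Hom(T, Tⁿ) → Hom(T, Y)` is induced by a morphism `Tⁿ ⟶ Y`. -/
lemma exists_map_eq_of_power {n : ℕ} {Y : C}
    (φ : (homFunctor k T).obj (power T n) ⟶ (homFunctor k T).obj Y) :
    ∃ f : power T n ⟶ Y, (homFunctor k T).map f = φ := by
  let y (i : Fin n) : T ⟶ Y := φ.hom.hom (biproduct.ι (fun _ : Fin n => T) i)
  refine ⟨biproduct.desc y, ?_⟩
  apply FGModuleCat.hom_ext
  apply LinearMap.ext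
  intro (x : T ⟶ power T n)
  change x ≫ biproduct.desc y = φ.hom.hom x
  -- The components of `x` act as scalars on the inclusions, so a linear map is determined by its
  -- values on the inclusions.
  have hx : x = ∑ i, (x ≫ biproduct.π _ i) ≫ biproduct.ι (fun _ : Fin n => T) i := by
    simp only [Category.assoc]
    rw [← Preadditive.comp_sum, biproduct.total, Category.comp_id]
  conv_rhs => rw [hx]
  refine Eq.trans ?_ (map_sum φ.hom.hom _ _).symm
  rw [biproduct.desc_eq, Preadditive.comp_sum]
  refine Finset.sum_congr rfl fun i _ => ?_
  rw [homFunctor_apply_comp]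
  exact (Category.assoc _ _ _).symm

/-- Every object has a right `add T`-approximation by a power of `T`. -/
lemma exists_right_approximation (k : Type w) [Field k] [Linear k C]
    [∀ X Y : C, Module.Finite k (X ⟶ Y)] (T X : C) :
    ∃ (n : ℕ) (f : power T n ⟶ X), ∀ x : T ⟶ X, ∃ y : T ⟶ power T n, y ≫ f = x := by
  obtain ⟨n, p, hp⟩ := exists_surjective_from_power k T ((homFunctor k T).obj X)
  obtain ⟨f, rfl⟩ := exists_map_eq_of_power k T p
  exact ⟨n, f, hp⟩

/-- Every finitely generated module is the cokernel of a map induced by some `Tᵐ ⟶ Tⁿ`. -/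
lemma exists_presentation (M : FGModuleCat.{v} (End T)ᵐᵒᵖ) :
    ∃ (m n : ℕ) (d : power T m ⟶ power T n) (p : (homFunctor k T).obj (power T n) ⟶ M),
      Function.Surjective p.hom.hom ∧
        ∀ x : T ⟶ power T n, p.hom.hom x = 0 ↔ ∃ y : T ⟶ power T m, y ≫ d = x := by
  obtain ⟨n, p, hp⟩ := exists_surjective_from_power k T M
  -- Noetherianity makes the kernel of `p` finitely generated, hence again a quotient of some
  -- `Hom(T, Tᵐ)`.
  have := isNoetherianRing_end_op k T
  obtain ⟨m, q, hq⟩ := exists_surjective_from_power k T (FGModuleCat.of _ (LinearMap.ker p.hom.hom))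
  obtain ⟨d, hd⟩ := exists_map_eq_of_power k T
    (q ≫ ⟨ModuleCat.ofHom (LinearMap.ker p.hom.hom).subtype⟩)
  have hd' (y : T ⟶ power T m) : y ≫ d = (q.hom.hom y).1 := by
    rw [← homFunctor_map_apply k, hd]
    rfl
  refine ⟨m, n, d, p, hp, fun x => ⟨fun hx => ?_, ?_⟩⟩
  · obtain ⟨y, hy⟩ := hq ⟨x, hx⟩
    exact ⟨y, (hd' y).trans (congrArg Subtype.val hy)⟩
  · rintro ⟨y, rfl⟩
    rw [hd']
    exact (q.hom.hom y).2

end Powers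

/-! ### The equivalence, from cones and rigidity -/

section Triangulated

variable (k : Type w) [Field k] {C : Type u} [Category.{v} C] [Preadditive C] [Linear k C]
  [∀ X Y : C, Module.Finite k (X ⟶ Y)]
  [HasZeroObject C] [HasShift C ℤ] [∀ n : ℤ, (shiftFunctor C n).Additive]
  [Pretriangulated C]

/-- The shift is additive, so a morphism to `Σ(Tⁿ)` is determined by its components in `ΣT`, which
vanish. -/
lemma IsRigid.hom_shift_power {T : C} (hT : IsRigid T) (n : ℕ) (f : T ⟶ (power T n)⟦(1 : ℤ)⟧) :
    f = 0 := by
  have h : 𝟙 ((power T n)⟦(1 : ℤ)⟧) = ∑ i, (biproduct.π (fun _ : Fin n => T) i)⟦(1 : ℤ)⟧' ≫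
      (biproduct.ι (fun _ : Fin n => T) i)⟦(1 : ℤ)⟧' := by
    simp_rw [← Functor.map_comp]
    rw [← Functor.map_sum, biproduct.total, CategoryTheory.Functor.map_id]
  rw [← Category.comp_id f, h, Preadditive.comp_sum]
  refine Finset.sum_eq_zero fun i _ => ?_
  rw [← Category.assoc, hT (f ≫ _), zero_comp]

/-- A morphism killed by `Hom(T, -)` factors through an object of `𝒳_T`. -/
lemma factorRel_zero_of_comp_eq_zero (k : Type w) [Field k] [Linear k C]
    [∀ X Y : C, Module.Finite k (X ⟶ Y)] {T : C} (hT : IsRigid T) {X Y : C} (f : X ⟶ Y)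
    (hf : ∀ x : T ⟶ X, x ≫ f = 0) : factorRel T f 0 := by
  obtain ⟨n, a, ha⟩ := exists_right_approximation k T X
  obtain ⟨Z, g, h, hZ⟩ := Pretriangulated.distinguished_cocone_triangle a
  obtain ⟨b, hb⟩ : ∃ b : Z ⟶ Y, f = g ≫ b :=
    Pretriangulated.Triangle.yoneda_exact₂ _ hZ f (power_hom_ext fun x =>
      (Category.assoc x a f).symm.trans ((hf _).trans comp_zero.symm))
  -- `Z` lies in `𝒳_T`: a map `T ⟶ Z` lifts to `X` by rigidity, then to the power of `T` through
  -- `a`, and `a ≫ g = 0`.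
  refine ⟨Z, g, b, fun x => ?_, by rw [sub_zero, hb]⟩
  obtain ⟨y, rfl⟩ : ∃ y : T ⟶ X, x = y ≫ g :=
    Pretriangulated.Triangle.coyoneda_exact₃ _ hZ x (hT.hom_shift_power n _)
  obtain ⟨z, rfl⟩ := ha y
  have : a ≫ g = 0 := Pretriangulated.comp_distTriang_mor_zero₁₂ _ hZ
  rw [Category.assoc, this, comp_zero]

/-- The functor induced by `H` on the factor category is faithful. -/
lemma homFactor_faithful {T : C} (hT : IsRigid T) : (homFactor k T).Faithful where
  map_injective {X Y} f g h := by
    obtain ⟨X⟩ := X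
    obtain ⟨Y⟩ := Y
    obtain ⟨f, rfl⟩ := (quotientFunctor T).map_surjective (X := X) (Y := Y) f
    obtain ⟨g, rfl⟩ := (quotientFunctor T).map_surjective (X := X) (Y := Y) g
    have h' : (homFunctor k T).map f = (homFunctor k T).map g := h
    rw [homFunctor_map_eq_iff] at h'
    obtain ⟨U, a, b, hU, e⟩ := factorRel_zero_of_comp_eq_zero k hT (f - g) fun x => by
      rw [Preadditive.comp_sub, h', sub_self]
    rw [CategoryTheory.Quotient.functor_map_eq_iff]
    exact ⟨U, a, b, hU, by rw [← e, sub_zero]⟩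

/-- Every finitely generated module is isomorphic to `Hom(T, X)` for an object `X` such that all
linear maps from `Hom(T, X)` are induced by morphisms from `X`. -/
lemma exists_iso_homFunctor_obj {T : C} (hT : IsRigid T) (M : FGModuleCat.{v} (End T)ᵐᵒᵖ) :
    ∃ X : C, Nonempty (M ≅ (homFunctor k T).obj X) ∧
      ∀ (Y : C) (φ : (homFunctor k T).obj X ⟶ (homFunctor k T).obj Y),
        ∃ f : X ⟶ Y, (homFunctor k T).map f = φ := by
  obtain ⟨m, n, d, p, hp, hker⟩ := exists_presentation k T M
  obtain ⟨X, c, g, hX⟩ := Pretriangulated.distinguished_cocone_triangle d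
  have hdc : d ≫ c = 0 := Pretriangulated.comp_distTriang_mor_zero₁₂ _ hX
  -- The obstruction to lifting along `c` lies in `Hom(T, Σ(Tᵐ))`, which is zero.
  have hc : Function.Surjective ((homFunctor k T).map c).hom.hom := fun (x : T ⟶ X) => by
    obtain ⟨y, hy⟩ := Pretriangulated.Triangle.coyoneda_exact₃ _ hX x (hT.hom_shift_power m _)
    exact ⟨y, hy.symm⟩
  have hkerc : LinearMap.ker p.hom.hom = LinearMap.ker ((homFunctor k T).map c).hom.hom := by
    refine Submodule.ext fun (x : T ⟶ power T n) => (hker x).trans ?_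
    change _ ↔ x ≫ c = 0
    constructor
    · rintro ⟨y, rfl⟩
      rw [Category.assoc, hdc, comp_zero]
    · intro hx
      obtain ⟨y, hy⟩ := Pretriangulated.Triangle.coyoneda_exact₂ _ hX x hx
      exact ⟨y, hy.symm⟩
  let e : M ≃ₗ[(End T)ᵐᵒᵖ] (homFunctor k T).obj X :=
    (p.hom.hom.quotKerEquivOfSurjective hp).symm ≪≫ₗ Submodule.quotEquivOfEq _ _ hkerc ≪≫ₗ
      ((homFunctor k T).map c).hom.hom.quotKerEquivOfSurjective hc
  refine ⟨X, ⟨(ModuleCat.isFG _).isoMk e.toModuleIso⟩, fun Y φ => ?_⟩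
  -- Lift `φ` first on `Tⁿ`; the lift kills `d`, so it descends to the cone `X`.
  obtain ⟨u, hu⟩ := exists_map_eq_of_power k T ((homFunctor k T).map c ≫ φ)
  have hdu : d ≫ u = 0 := power_hom_ext fun x => by
    rw [comp_zero, ← Category.assoc, ← homFunctor_map_apply k, hu]
    change φ.hom.hom ((x ≫ d) ≫ c) = 0
    rw [Category.assoc, hdc, comp_zero]
    exact φ.hom.hom.map_zero
  obtain ⟨f, hf⟩ : ∃ f : X ⟶ Y, u = c ≫ f := Pretriangulated.Triangle.yoneda_exact₂ _ hX u hdu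
  refine ⟨f, FGModuleCat.hom_ext (LinearMap.ext fun x => ?_)⟩
  obtain ⟨y, rfl⟩ := hc x
  have h : (homFunctor k T).map c ≫ (homFunctor k T).map f = (homFunctor k T).map c ≫ φ := by
    rw [← Functor.map_comp, ← hf, hu]
  exact congrArg (fun ψ => ψ.hom.hom y) h

/-- The functor induced by `H` on the factor category has a fully faithful left adjoint. -/
lemma exists_adjunction {T : C} (hT : IsRigid T) :
    ∃ (F : FGModuleCat.{v} (End T)ᵐᵒᵖ ⥤ FactorCategory T) (_ : F ⊣ homFactor k T),
      F.Full ∧ F.Faithful := by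
  have := homFactor_faithful k hT
  choose X e hX using exists_iso_homFunctor_obj k hT
  let i (M) : M ≅ (homFactor k T).obj ((quotientFunctor T).obj (X M)) := (e M).some
  have bij (M : FGModuleCat.{v} (End T)ᵐᵒᵖ) (Y : FactorCategory T) :
      Function.Bijective fun f : (quotientFunctor T).obj (X M) ⟶ Y =>
        (i M).hom ≫ (homFactor k T).map f := by
    constructor
    · intro f g h
      exact (homFactor k T).map_injective ((cancel_epi (i M).hom).1 h)
    · intro φ
      obtain ⟨Y⟩ := Y
      obtain ⟨f, hf⟩ := hX M Y ((i M).inv ≫ φ)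
      exact ⟨(quotientFunctor T).map f, (Iso.eq_inv_comp _).1 hf⟩
  let adj := Adjunction.adjunctionOfEquivLeft (G := homFactor k T)
    (fun M Y => Equiv.ofBijective _ (bij M Y)) (fun M Y Y' g h => by simp)
  -- The unit at `M` is the chosen isomorphism `i M`; an invertible unit makes the left adjoint
  -- fully faithful.
  have hunit : IsIso adj.unit := by
    have (M : FGModuleCat.{v} (End T)ᵐᵒᵖ) : IsIso (adj.unit.app M) := by
      have : adj.unit.app M = (i M).hom := by
        simp [adj]
      rw [this]
      infer_instance
    exact NatIso.isIso_of_isIso_app _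
  exact ⟨_, adj, adj.fullyFaithfulLOfIsIsoUnit.full, adj.fullyFaithfulLOfIsIsoUnit.faithful⟩

/-- The regular morphisms are those inverted by `H`. -/
lemma regular_eq_inverseImage {T : C} (hT : IsRigid T) :
    regular T = (MorphismProperty.isomorphisms _).inverseImage (homFactor k T) := by
  have := homFactor_faithful k hT
  apply le_antisymm
  · exact fun X Y f hf => homFactor_inverts k T f hf
  · intro X Y f (hf : IsIso ((homFactor k T).map f))
    exact ⟨(homFactor k T).mono_of_mono_map inferInstance,
      (homFactor k T).epi_of_epi_map inferInstance⟩

/-- A right adjoint of a fully faithful functor is a localisation at the morphisms it inverts, here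
the regular ones. Two localisations at the same class are equivalent by the comparison functor,
which is `H'`. -/
lemma inducedHom_isEquivalence {T : C} (hT : IsRigid T) : (inducedHom k T).IsEquivalence := by
  obtain ⟨F, adj, _, _⟩ := exists_adjunction k hT
  have : (homFactor k T).IsLocalization (regular T) := by
    rw [regular_eq_inverseImage k hT]
    exact adj.isLocalization_rightAdjoint'
  exact this.isEquivalence

end Triangulated

/-! ### Biproducts in the factor category and its localisation -/

section Additive

variable {C : Type u} [Category.{v} C] [Preadditive C] [HasZeroObject C] [HasBinaryBiproducts C]

instance (T : C) : (quotientFunctor T).Additive where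

instance (T : C) : HasBinaryBiproducts (FactorCategory T) where
  has_binary_biproduct X Y := by
    obtain ⟨X⟩ := X
    obtain ⟨Y⟩ := Y
    have : PreservesBinaryBiproduct X Y (quotientFunctor T) :=
      preservesBinaryBiproduct_of_preservesBiproduct _ _ _
    exact ⟨⟨_, isBinaryBilimitOfPreserves (quotientFunctor T) (BinaryBiproduct.isBilimit X Y)⟩⟩

lemma hasBinaryBiproducts_localisation (T : C) [Preadditive (Localisation T)]
    [(localisationFunctor T).Additive] : HasBinaryBiproducts (Localisation T) where
  has_binary_biproduct X Y := by
    obtain ⟨⟨X⟩⟩ := X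
    obtain ⟨⟨Y⟩⟩ := Y
    have : PreservesBinaryBiproduct X Y (localisationFunctor T) :=
      preservesBinaryBiproduct_of_preservesBiproduct _ _ _
    exact HasBinaryBiproduct.mk ⟨_, isBinaryBilimitOfPreserves (localisationFunctor T)
      (BinaryBiproduct.isBilimit X Y)⟩

end Additive

/-! ### Additive structures and the functor represented by `T` -/

section Equivalence

variable (k : Type w) [Field k] {C : Type u} [Category.{v} C] [Preadditive C] [Linear k C]
  [∀ X Y : C, Module.Finite k (X ⟶ Y)]
  [HasZeroObject C] [HasShift C ℤ] [∀ n : ℤ, (shiftFunctor C n).Additive]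
  [Pretriangulated C]

instance (T : C) : (homFactor k T).Additive where
  map_add {X Y} f g := by
    obtain ⟨X⟩ := X
    obtain ⟨Y⟩ := Y
    obtain ⟨f, rfl⟩ := (quotientFunctor T).map_surjective (X := X) (Y := Y) f
    obtain ⟨g, rfl⟩ := (quotientFunctor T).map_surjective (X := X) (Y := Y) g
    apply FGModuleCat.hom_ext
    apply LinearMap.ext
    intro (x : T ⟶ X)
    exact Preadditive.comp_add _ _ _ x f g

lemma exists_preadditive_localisation (k : Type w) [Field k] [Linear k C]
    [∀ X Y : C, Module.Finite k (X ⟶ Y)] {T : C} (hT : IsRigid T) :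
    ∃ _ : Preadditive (Localisation T), (localisationFunctor T).Additive := by
  have := inducedHom_isEquivalence k hT
  let hF := Functor.FullyFaithful.ofFullyFaithful (inducedHom k T)
  let := Preadditive.ofFullyFaithful hF
  have := hF.additive_ofFullyFaithful
  refine ⟨inferInstance, ⟨fun {X Y f g} => (inducedHom k T).map_injective ?_⟩⟩
  -- Since `H'` after the localisation functor is `homFactor`, the goal becomes additivity of the
  -- latter.
  rw [(inducedHom k T).map_add]
  exact (homFactor k T).map_add

/-- The additive structure is arbitrary here, not the transported one. Biproducts pass to the
localisation, and an equivalence preserves binary products, which forces additivity. -/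
lemma inducedHom_additive {T : C} (hT : IsRigid T) [Preadditive (Localisation T)]
    [(localisationFunctor T).Additive] : (inducedHom k T).Additive := by
  have := inducedHom_isEquivalence k hT
  have := hasBinaryBiproducts_localisation T
  exact Functor.additive_of_preserves_binary_products _

/-- Evaluation at the identity of `T`. -/
noncomputable def inducedHomEval (T : C) {X : Localisation T} (f : toLocalisation T T ⟶ X) :
    ((inducedHom k T).obj X).obj :=
  ((inducedHom k T).map f).hom.hom (𝟙 T : T ⟶ T)

lemma inducedHomEval_comp (T : C) {X Y : Localisation T} (f : toLocalisation T T ⟶ X) (g : X ⟶ Y) :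
    inducedHomEval k T (f ≫ g) = ((inducedHom k T).map g).hom.hom (inducedHomEval k T f) := by
  rw [inducedHomEval, Functor.map_comp]
  rfl

lemma inducedHomEval_add {T : C} [Preadditive (Localisation T)] [(inducedHom k T).Additive]
    {X : Localisation T} (f g : toLocalisation T T ⟶ X) :
    inducedHomEval k T (f + g) = inducedHomEval k T f + inducedHomEval k T g := by
  rw [inducedHomEval, Functor.map_add]
  rfl

lemma inducedHomEval_endHom_comp (T : C) [Preadditive (Localisation T)]
    [(localisationFunctor T).Additive] {X : Localisation T} (r : End T)
    (f : toLocalisation T T ⟶ X) :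
    inducedHomEval k T (endHom T r ≫ f) = MulOpposite.op r • inducedHomEval k T f := by
  rw [inducedHomEval_comp]
  refine Eq.trans ?_ (((inducedHom k T).map f).hom.hom.map_smul (MulOpposite.op r) (𝟙 T : T ⟶ T))
  refine congrArg ((inducedHom k T).map f).hom.hom ?_
  -- `H'` turns `endHom T r` into postcomposition with `r`, whereas scalars act by precomposition;
  -- the two agree at the identity.
  change (𝟙 T ≫ r : T ⟶ T) = r ≫ 𝟙 T
  rw [Category.id_comp, Category.comp_id]

/-- `H'` is fully faithful and `H'(T)` is free of rank one on the identity, so a morphism from `T`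
amounts to an element of `H'(X)`. -/
lemma inducedHomEval_bijective {T : C} (hT : IsRigid T) (X : Localisation T) :
    Function.Bijective (inducedHomEval k T (X := X)) := by
  have := inducedHom_isEquivalence k hT
  constructor
  · intro f g h
    apply (inducedHom k T).map_injective
    apply FGModuleCat.hom_ext
    apply LinearMap.ext
    intro (x : T ⟶ T)
    have e (f : toLocalisation T T ⟶ X) : ((inducedHom k T).map f).hom.hom x =
        MulOpposite.op (show End T from x) • inducedHomEval k T f := by
      refine Eq.trans ?_ (((inducedHom k T).map f).hom.hom.map_smul
        (MulOpposite.op (show End T from x)) (𝟙 T : T ⟶ T))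
      exact congrArg ((inducedHom k T).map f).hom.hom (Category.comp_id x).symm
    rw [e, e, h]
  · intro y
    let φ : ((inducedHom k T).obj (toLocalisation T T)).obj →ₗ[(End T)ᵐᵒᵖ]
        ((inducedHom k T).obj X).obj :=
      { toFun := fun x : T ⟶ T => MulOpposite.op (show End T from x) • y
        map_add' := fun x x' => add_smul (R := (End T)ᵐᵒᵖ) _ _ y
        map_smul' := fun r x => mul_smul (α := (End T)ᵐᵒᵖ) r _ y }
    obtain ⟨f, hf⟩ := (inducedHom k T).map_surjective ⟨ModuleCat.ofHom φ⟩
    refine ⟨f, ?_⟩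
    rw [inducedHomEval, hf]
    exact one_smul (End T)ᵐᵒᵖ y

/-- `H'` agrees with the functor represented by `T` in the localisation. -/
noncomputable def inducedHomIso {T : C} (hT : IsRigid T) [Preadditive (Localisation T)]
    [(localisationFunctor T).Additive] :
    inducedHom k T ⋙ (ModuleCat.isFG _).ι ⋙ ModuleCat.uliftFunctor.{u} _ ≅ homLocalisation T :=
  have := inducedHom_additive k hT
  (NatIso.ofComponents (fun X => (LinearEquiv.toModuleIso
    (X₁ := (homLocalisation T).obj X) (X₂ := ULift.{u} ((inducedHom k T).obj X).obj) <|
    LinearEquiv.ofBijective (M := (homLocalisation T).obj X)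
      (M₂ := ULift.{u} ((inducedHom k T).obj X).obj)
    { toFun := fun f : toLocalisation T T ⟶ X => ULift.up (inducedHomEval k T f)
      map_add' := fun f g => ULift.ext _ _ <| inducedHomEval_add k f g
      map_smul' := fun r f => ULift.ext _ _ <| inducedHomEval_endHom_comp k T r.unop f }
    (Equiv.ulift.symm.bijective.comp (inducedHomEval_bijective k hT X))))
    fun g => ModuleCat.hom_ext <| LinearMap.ext fun f =>
      ULift.ext _ _ <| inducedHomEval_comp k T f g).symm

/-- Morphisms of the localisation live in universe `max u v` and the values of `H'` in `v`, whence
the lift. No finitely generated module is lost: being a quotient of a finite power of a ring in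
`Type v`, it is `v`-small. -/
lemma essImage_inducedHom_ulift {T : C} (hT : IsRigid T) :
    (inducedHom k T ⋙ (ModuleCat.isFG _).ι ⋙ ModuleCat.uliftFunctor.{u} _).essImage =
      ModuleCat.isFG.{max u v} (End T)ᵐᵒᵖ := by
  have := inducedHom_isEquivalence k hT
  ext M
  constructor
  · rintro ⟨X, ⟨e⟩⟩
    have : Module.Finite (End T)ᵐᵒᵖ ((inducedHom k T).obj X).obj := ((inducedHom k T).obj X).property
    exact Module.Finite.equiv (M := ((inducedHom k T).obj X).obj)
      (ULift.moduleEquiv.symm ≪≫ₗ e.toLinearEquiv)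
  · intro (hM : Module.Finite (End T)ᵐᵒᵖ M)
    obtain ⟨n, f, hf⟩ := Module.Finite.exists_fin' (End T)ᵐᵒᵖ M
    have : Small.{v} M := small_of_surjective hf
    have : Module.Finite (End T)ᵐᵒᵖ (Shrink.{v} M) :=
      Module.Finite.equiv (Shrink.linearEquiv (End T)ᵐᵒᵖ M).symm
    let N : FGModuleCat.{v} (End T)ᵐᵒᵖ := FGModuleCat.of _ (Shrink.{v} M)
    refine ⟨(inducedHom k T).objPreimage N,
      ⟨((ModuleCat.isFG _).ι ⋙ ModuleCat.uliftFunctor.{u} _).mapIso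
        ((inducedHom k T).objObjPreimageIso N) ≪≫ LinearEquiv.toModuleIso
          (X₁ := ULift.{u} (Shrink.{v} M)) (X₂ := M)
          (ULift.moduleEquiv ≪≫ₗ Shrink.linearEquiv (End T)ᵐᵒᵖ M)⟩⟩

end Equivalence

end RigidLocalisation

open RigidLocalisation in
theorem lemma7p3 (k : Type w) [Field k] (C : Type u) [Category.{v} C] [EssentiallySmall.{v} C]
    [Preadditive C] [Linear k C] [HasZeroObject C] [HasShift C ℤ]
    [∀ n : ℤ, (shiftFunctor C n).Additive] [∀ n : ℤ, (shiftFunctor C n).Linear k]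
    [Pretriangulated C] [IsTriangulated C]
    [∀ X Y : C, Module.Finite k (X ⟶ Y)]
    (hKS : IsKrullSchmidt C) (hSerre : HasSerreDuality k C)
    (T : C) (hT : IsRigid T) :
    (∃ _ : Preadditive (Localisation T), (localisationFunctor T).Additive) ∧
    (∀ [Preadditive (Localisation T)] [(localisationFunctor T).Additive],
      Nonempty (inducedHom k T ⋙ (ModuleCat.isFG _).ι ⋙ ModuleCat.uliftFunctor.{u} _ ≅
        homLocalisation T) ∧
      (homLocalisation T).Full ∧ (homLocalisation T).Faithful ∧
      (homLocalisation T).essImage = ModuleCat.isFG _) ∧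
    (inducedHom k T).IsEquivalence := by
  have hE := inducedHom_isEquivalence k hT
  refine ⟨exists_preadditive_localisation k hT, ?_, hE⟩
  intro _ _
  let e := inducedHomIso k hT
  refine ⟨⟨e⟩, Functor.Full.of_iso e, Functor.Faithful.of_iso e, ?_⟩
  rw [← essImage_inducedHom_ulift k hT]
  exact (Functor.essImage_eq_of_natIso e).symm
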